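/- Call a compact set $\mathcal C\subset\mathbb R^3$ an obstacle if $\mathbb R^3\setminus\mathcal C$ is simply connected; it is a smooth obstacle if moreover its boundary is smooth, i.e. near every boundary point $\mathcal C$ is a sublevel set $\{\rho\le 0\}$ of a $C^\infty$ function $\rho$ with $\nabla\rho\neq0$ at that point. For an open set $\Omega\subset\mathbb R^3$ let $V(\Omega)$ be the space of divergence free vector fields in $C_c^\infty(\Omega;\mathbb R^3)$, let $\mathcal H(\Omega)$ be the closure of $V(\Omega)$ in $L^2(\Omega;\mathbb R^3)$, and let $\mathbb P_\Omega:L^2(\Omega;\mathbb R^3)\to\mathcal H(\Omega)$ be the Leray projection, i.e. the orthogonal projection onto $\mathcal H(\Omega)$. Let $\mathcal C$ be an obstacle (no regularity is assumed), and let $(\mathcal C_n)_{n\in\mathbb N}$ be a sequence of smooth obstacles with $\mathcal C\subset\mathcal C_n$ for all $n$ that converges to $\mathcal C$ in the Hausdorff distance. Put $\Omega=\mathbb R^3\setminus\mathcal C$ and $\Omega_n=\mathbb R^3\setminus\mathcal C_n$. Let $\omega_0\in V(\mathbb R^3)$ and let $$v_0(x)=-\int_{\mathbb R^3}\frac{x-y}{4\pi|x-y|^3}\times\omega_0(y)\,dy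 .$$ Then $v_0\in L^2(\mathbb R^3)$ and $$E\bigl(\mathbb P_{\Omega_n}(v_0|_{\Omega_n})\bigr)\longrightarrow \mathbb P_\Omega(v_0|_\Omega)\quad\text{strongly in } L^2(\Omega),$$ where $E f$ denotes the extension by zero to $\mathbb R^3$ of a field $f$ on $\Omega_n$. -/

import Mathlib

open MeasureTheory Filter Topology
open scoped ContDiff

/-- Three-dimensional Euclidean space. -/
abbrev E3 : Type := EuclideanSpace ℝ (Fin 3)

/-- An obstacle: a compact subset of `ℝ³` whose complement is simply connected. -/
structure IsObstacle (C : Set E3) : Prop where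
  isCompact : IsCompact C
  isSimplyConnected_compl : IsSimplyConnected Cᶜ

/-- A closed set with smooth boundary: near each boundary point it is the sublevel set
`{ρ ≤ 0}` of a smooth function `ρ` with nonvanishing differential there. -/
def HasSmoothBoundary (C : Set E3) : Prop :=
  ∀ x ∈ frontier C, ∃ U : Set E3, IsOpen U ∧ x ∈ U ∧ ∃ ρ : E3 → ℝ,
    ContDiffOn ℝ ∞ ρ U ∧ fderiv ℝ ρ x ≠ 0 ∧ ∀ y ∈ U, y ∈ C ↔ ρ y ≤ 0

/-- A smooth obstacle. -/
structure IsSmoothObstacle (C : Set E3) : Prop extends IsObstacle C where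
  smooth : HasSmoothBoundary C

/-- The divergence `∂₁φ₁ + ∂₂φ₂ + ∂₃φ₃` of a differentiable vector field. -/
noncomputable def divergence (φ : E3 → E3) (x : E3) : ℝ :=
  ∑ i : Fin 3, fderiv ℝ φ x (EuclideanSpace.single i 1) i

/-- `V(Ω)`: smooth divergence free vector fields with compact support in `Ω`. -/
def solenoidalTest (Ω : Set E3) : Submodule ℝ (E3 → E3) where
  carrier := {φ | ContDiff ℝ ∞ φ ∧ HasCompactSupport φ ∧ tsupport φ ⊆ Ω ∧
    ∀ x ∈ Ω, divergence φ x = 0}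
  zero_mem' := by
    refine ⟨contDiff_const, HasCompactSupport.zero, by simp [tsupport], fun x _ => ?_⟩
    simp [divergence]
  add_mem' := by
    rintro φ ψ ⟨h1, h2, h3, h4⟩ ⟨k1, k2, k3, k4⟩
    refine ⟨h1.add k1, h2.add k2, (tsupport_add φ ψ).trans (Set.union_subset h3 k3),
      fun x hx => ?_⟩
    have hφ : DifferentiableAt ℝ φ x := h1.differentiable (by simp) x
    have hψ : DifferentiableAt ℝ ψ x := k1.differentiable (by simp) x
    have e : divergence (φ + ψ) x = divergence φ x + divergence ψ x := by
      simp [divergence, fderiv_add hφ hψ, Finset.sum_add_distrib]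
    rw [e, h4 x hx, k4 x hx, add_zero]
  smul_mem' := by
    rintro c φ ⟨h1, h2, h3, h4⟩
    refine ⟨contDiff_const.smul h1, h2.smul_left (f := fun _ => c),
      (closure_mono (Function.support_const_smul_subset c φ)).trans h3, fun x hx => ?_⟩
    have hφ : DifferentiableAt ℝ φ x := h1.differentiable (by simp) x
    have e : divergence (c • φ) x = c * divergence φ x := by
      simp [divergence, fderiv_const_smul hφ, Finset.mul_sum]
    rw [e, h4 x hx, mul_zero]

/-- `L²(Ω)`: square integrable vector fields on `Ω`. -/
abbrev L2Field (Ω : Set E3) : Type := Lp E3 2 ((volume : Measure E3).restrict Ω)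

/-- The classes in `L²(Ω)` of the fields in `V(Ω)`. -/
def solenoidalTestL2 (Ω : Set E3) : Submodule ℝ (L2Field Ω) where
  carrier := {f | ∃ φ ∈ solenoidalTest Ω, f =ᵐ[(volume : Measure E3).restrict Ω] φ}
  zero_mem' := ⟨0, Submodule.zero_mem _, Lp.coeFn_zero _ _ _⟩
  add_mem' := by
    rintro f g ⟨φ, hφ, hf⟩ ⟨ψ, hψ, hg⟩
    exact ⟨φ + ψ, Submodule.add_mem _ hφ hψ, (Lp.coeFn_add f g).trans (hf.add hg)⟩
  smul_mem' := by
    rintro c f ⟨φ, hφ, hf⟩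
    exact ⟨c • φ, Submodule.smul_mem _ c hφ, (Lp.coeFn_smul c f).trans (hf.const_smul c)⟩

/-- `𝓗(Ω)`: the closure of `V(Ω)` in `L²(Ω)`. -/
noncomputable def solenoidalSpace (Ω : Set E3) : Submodule ℝ (L2Field Ω) :=
  (solenoidalTestL2 Ω).topologicalClosure

noncomputable instance (Ω : Set E3) : (solenoidalSpace Ω).HasOrthogonalProjection :=
  inferInstanceAs (solenoidalTestL2 Ω).topologicalClosure.HasOrthogonalProjection

/-- The Leray projection `ℙ_Ω`: the orthogonal projection of `L²(Ω)` onto `𝓗(Ω)`. -/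
noncomputable def lerayProjection (Ω : Set E3) : L2Field Ω →L[ℝ] solenoidalSpace Ω :=
  (solenoidalSpace Ω).orthogonalProjectionOnto

/-- The vector product in `ℝ³`. -/
def cross (a b : E3) : E3 := WithLp.toLp 2 (crossProduct a.ofLp b.ofLp)

/-- The Biot-Savart field `x ↦ -∫ (x - y) / (4π |x - y|³) × w(y) dy`. -/
noncomputable def biotSavart (w : E3 → E3) (x : E3) : E3 :=
  -∫ y : E3, cross ((1 / (4 * Real.pi * ‖x - y‖ ^ 3)) • (x - y)) (w y)

/-- The restriction to `Ω` of a square integrable field on `ℝ³`, as an element of `L²(Ω)`. -/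
noncomputable def restrictL2 (Ω : Set E3) {v : E3 → E3} (hv : MemLp v 2 volume) : L2Field Ω :=
  (hv.restrict Ω).toLp v

/-- The extension by zero to `ℝ³` of a field on `Ω`. -/
noncomputable def extendZero (Ω : Set E3) (f : L2Field Ω) : E3 → E3 :=
  Ω.indicator f

open scoped ENNReal

/-
The Biot–Savart kernel is bounded by `|z|⁻²`, which is integrable near the origin and square
integrable near infinity. By Young's inequality it therefore maps `L¹ ∩ L²` into `L²`.

Seen inside `L²(ℝ³)`, the extension by zero of `ℙ_Ω (v|_Ω)` is the orthogonal projection of `v` onto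
the closure of the test fields of `Ω`. The spaces belonging to the `Ω_n` lie in the one belonging to
`Ω`, and a test field of `Ω` belongs to all but finitely many of them, because its support has
positive distance to `C` and hence avoids `C_n` as soon as `C_n` is close to `C`. So the limit space
is approximated from within, and the projections converge strongly.
-/

section Young

variable {α : Type*} [MeasurableSpace α]

theorem lintegral_mul_rpow_le {μ : Measure α} {f g : α → ℝ≥0∞} (hf : AEMeasurable f μ)
    (hg : AEMeasurable g μ) {p : ℝ} (hp : 1 ≤ p) :
    (∫⁻ a, f a * g a ∂μ) ^ p ≤ (∫⁻ a, f a ∂μ) ^ (p - 1) * ∫⁻ a, f a * g a ^ p ∂μ := by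
  have hp₀ : 0 < p := by linarith
  have hq : 0 ≤ 1 - p⁻¹ := sub_nonneg.2 (inv_le_one_of_one_le₀ hp)
  have hsplit : ∀ a, f a ^ (1 - p⁻¹) * (f a * g a ^ p) ^ p⁻¹ = f a * g a := fun a => by
    rw [ENNReal.mul_rpow_of_nonneg _ _ (by positivity), ENNReal.rpow_rpow_inv hp₀.ne', ← mul_assoc,
      ← ENNReal.rpow_add_of_nonneg _ _ hq (by positivity), sub_add_cancel, ENNReal.rpow_one]
  have hholder := ENNReal.lintegral_mul_norm_pow_le hf (hf.mul (hg.pow_const p)) hq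
    (inv_nonneg.2 hp₀.le) (sub_add_cancel _ _)
  simp only [Pi.mul_apply, hsplit] at hholder
  calc (∫⁻ a, f a * g a ∂μ) ^ p
      ≤ ((∫⁻ a, f a ∂μ) ^ (1 - p⁻¹) * (∫⁻ a, f a * g a ^ p ∂μ) ^ p⁻¹) ^ p := by gcongr
    _ = (∫⁻ a, f a ∂μ) ^ (p - 1) * ∫⁻ a, f a * g a ^ p ∂μ := by
      rw [ENNReal.mul_rpow_of_nonneg _ _ hp₀.le, ENNReal.rpow_inv_rpow hp₀.ne', ← ENNReal.rpow_mul,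
        sub_mul, inv_mul_cancel₀ hp₀.ne', one_mul]

variable {G : Type*} [MeasurableSpace G]

section AddGroup

variable [AddGroup G] [MeasurableAdd₂ G] [MeasurableNeg G] {μ : Measure G}
  [μ.IsAddLeftInvariant] [SFinite μ] {f g : G → ℝ≥0∞}

theorem lintegral_lconvolution (hf : AEMeasurable f μ) (hg : AEMeasurable g μ) :
    ∫⁻ x, (f ⋆ₗ[μ] g) x ∂μ = (∫⁻ x, f x ∂μ) * ∫⁻ x, g x ∂μ := by
  simp only [lconvolution_def]
  rw [lintegral_lintegral_swap (by fun_prop), ← lintegral_mul_const'' _ hf]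
  refine lintegral_congr fun y => ?_
  have hgy : AEMeasurable (fun x => g (-y + x)) μ :=
    hg.comp_quasiMeasurePreserving (measurePreserving_add_left μ (-y)).quasiMeasurePreserving
  rw [lintegral_const_mul'' _ hgy, lintegral_add_left_eq_self g (-y)]

theorem lintegral_lconvolution_rpow_le (hf : AEMeasurable f μ) (hg : AEMeasurable g μ) {p : ℝ}
    (hp : 1 ≤ p) :
    ∫⁻ x, (f ⋆ₗ[μ] g) x ^ p ∂μ ≤ (∫⁻ x, f x ∂μ) ^ p * ∫⁻ x, g x ^ p ∂μ := by
  have hgp : AEMeasurable (fun x => g x ^ p) μ := hg.pow_const p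
  calc ∫⁻ x, (f ⋆ₗ[μ] g) x ^ p ∂μ
      ≤ ∫⁻ x, (∫⁻ y, f y ∂μ) ^ (p - 1) * (f ⋆ₗ[μ] fun y => g y ^ p) x ∂μ :=
        lintegral_mono fun x => lintegral_mul_rpow_le hf (by fun_prop) hp
    _ = (∫⁻ x, f x ∂μ) ^ (p - 1) * ((∫⁻ x, f x ∂μ) * ∫⁻ x, g x ^ p ∂μ) := by
        rw [lintegral_const_mul'' _ (by fun_prop), lintegral_lconvolution hf hgp]
    _ = (∫⁻ x, f x ∂μ) ^ p * ∫⁻ x, g x ^ p ∂μ := by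
        nth_rw 2 [← ENNReal.rpow_one (∫⁻ x, f x ∂μ)]
        rw [← mul_assoc, ← ENNReal.rpow_add_of_nonneg _ _ (sub_nonneg.2 hp) zero_le_one,
          sub_add_cancel]

end AddGroup

section AddCommGroup

variable [AddCommGroup G] [MeasurableAdd₂ G] [MeasurableNeg G] {μ : Measure G}
  [μ.IsAddLeftInvariant] [μ.IsNegInvariant] [SFinite μ] {f g : G → ℝ≥0∞}

theorem eLpNorm_lconvolution_le (hf : AEMeasurable f μ) (hg : AEMeasurable g μ) {p : ℝ≥0∞}
    (hp : 1 ≤ p) :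
    eLpNorm (f ⋆ₗ[μ] g) p μ ≤ eLpNorm f 1 μ * eLpNorm g p μ := by
  rw [eLpNorm_one_eq_lintegral_enorm]
  simp only [enorm_eq_self]
  rcases eq_or_ne p ⊤ with rfl | hp_top
  · refine eLpNormEssSup_le_of_ae_enorm_bound (ae_of_all _ fun x => ?_)
    rw [enorm_eq_self, lconvolution_def, ← lintegral_mul_const'' _ hf]
    have hbound : ∀ᵐ y ∂μ, g (-y + x) ≤ eLpNorm g ⊤ μ := by
      have hsub : Measure.QuasiMeasurePreserving (fun y => -y + x) μ μ := by
        simpa only [neg_add_eq_sub] using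
          (Measure.measurePreserving_sub_left μ x).quasiMeasurePreserving
      exact hsub.ae (by simpa using enorm_ae_le_eLpNormEssSup g μ)
    exact lintegral_mono_ae (hbound.mono fun y hy => by gcongr)
  · have hp_zero : p ≠ 0 := (zero_lt_one.trans_le hp).ne'
    have hp_one : 1 ≤ p.toReal := by simpa using ENNReal.toReal_mono hp_top hp
    have hp_pos : 0 < p.toReal := by linarith
    simp only [eLpNorm_eq_lintegral_rpow_enorm_toReal hp_zero hp_top, enorm_eq_self, one_div]
    rw [ENNReal.rpow_inv_le_iff hp_pos, ENNReal.mul_rpow_of_nonneg _ _ hp_pos.le,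
      ENNReal.rpow_inv_rpow hp_pos.ne']
    exact lintegral_lconvolution_rpow_le hf hg hp_one

theorem memLp_add_lconvolution {k₁ k₂ : G → ℝ≥0∞} {p : ℝ≥0∞} (hp : 1 ≤ p) (hk₁ : MemLp k₁ 1 μ)
    (hk₂ : MemLp k₂ p μ) (hg₁ : MemLp g 1 μ) (hg₂ : MemLp g p μ) :
    MemLp ((k₁ + k₂) ⋆ₗ[μ] g) p μ := by
  have hk₁m := hk₁.aemeasurable
  have hk₂m := hk₂.aemeasurable
  have hgm := hg₁.aemeasurable
  have hsplit : (k₁ + k₂) ⋆ₗ[μ] g = k₁ ⋆ₗ[μ] g + g ⋆ₗ[μ] k₂ := by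
    rw [lconvolution_comm (f := g)]
    funext x
    simp only [lconvolution_def, Pi.add_apply, add_mul]
    exact lintegral_add_left' (by fun_prop) _
  rw [hsplit]
  refine MemLp.add ⟨by fun_prop, ?_⟩ ⟨by fun_prop, ?_⟩
  · exact (eLpNorm_lconvolution_le hk₁m hgm hp).trans_lt (ENNReal.mul_lt_top hk₁.2 hg₂.2)
  · exact (eLpNorm_lconvolution_le hgm hk₂m hp).trans_lt (ENNReal.mul_lt_top hg₁.2 hk₂.2)

end AddCommGroup

end Young

section Kernel

variable {E : Type*} [NormedAddCommGroup E] [NormedSpace ℝ E] [FiniteDimensional ℝ E]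
  [MeasurableSpace E] [BorelSpace E] {μ : Measure E} [μ.IsAddHaarMeasure] {r : ℝ}

theorem memLp_one_indicator_ball_norm_rpow_neg [Nontrivial E] (hr : r < Module.finrank ℝ E) :
    MemLp ((Metric.ball 0 1).indicator fun x : E => ‖x‖ ^ (-r)) 1 μ := by
  rw [memLp_indicator_iff_restrict Metric.isOpen_ball.measurableSet, memLp_one_iff_integrable]
  refine integrableOn_ball_of_norm_le_rpow (C := 1) Module.finrank_pos hr
    (ae_of_all _ fun x => ?_) (Measurable.aestronglyMeasurable (by fun_prop))
  rw [one_mul, Real.norm_of_nonneg (by positivity)]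

theorem integrableOn_compl_ball_norm_rpow_neg (hr : Module.finrank ℝ E < r) :
    IntegrableOn (fun x : E => ‖x‖ ^ (-r)) (Metric.ball 0 1)ᶜ μ := by
  refine (((integrable_one_add_norm hr).const_mul (2 ^ r)).integrableOn).mono'
    (Measurable.aestronglyMeasurable (by fun_prop)) ?_
  filter_upwards [ae_restrict_mem Metric.isOpen_ball.measurableSet.compl] with x hx
  have hx : 1 ≤ ‖x‖ := by simpa using hx
  have hr_nonneg : 0 ≤ r := (Nat.cast_nonneg _).trans hr.le
  rw [Real.norm_of_nonneg (by positivity)]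
  calc ‖x‖ ^ (-r) ≤ ((1 + ‖x‖) / 2) ^ (-r) :=
        Real.rpow_le_rpow_of_nonpos (by positivity) (by linarith) (neg_nonpos.2 hr_nonneg)
    _ = 2 ^ r * (1 + ‖x‖) ^ (-r) := by
        rw [Real.div_rpow (by positivity) (by positivity), Real.rpow_neg zero_le_two,
          div_inv_eq_mul, mul_comm]

theorem memLp_indicator_compl_ball_norm_rpow_neg {p : ℝ≥0∞} (hp : p ≠ ⊤)
    (hr : Module.finrank ℝ E < r * p.toReal) :
    MemLp ((Metric.ball 0 1)ᶜ.indicator fun x : E => ‖x‖ ^ (-r)) p μ := by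
  have hp₀ : p ≠ 0 := by
    rintro rfl
    exact (Nat.cast_nonneg (α := ℝ) (Module.finrank ℝ E)).not_gt (by simpa using hr)
  rw [memLp_indicator_iff_restrict Metric.isOpen_ball.measurableSet.compl,
    ← integrable_norm_rpow_iff (Measurable.aestronglyMeasurable (by fun_prop)) hp₀ hp]
  refine (integrableOn_compl_ball_norm_rpow_neg hr).congr (ae_of_all _ fun x => ?_)
  simp only
  rw [Real.norm_of_nonneg (by positivity), ← Real.rpow_mul (norm_nonneg x), neg_mul]

theorem memLp_lconvolution_norm_rpow_neg {p : ℝ≥0∞} (hp : 1 ≤ p) (hp_top : p ≠ ⊤)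
    (hr : r < Module.finrank ℝ E) (hrp : Module.finrank ℝ E < r * p.toReal) {g : E → ℝ≥0∞}
    (hg₁ : MemLp g 1 μ) (hg₂ : MemLp g p μ) :
    MemLp ((fun x => ‖‖x‖ ^ (-r)‖ₑ) ⋆ₗ[μ] g) p μ := by
  have hr_pos : 0 < r :=
    pos_of_mul_pos_left ((Nat.cast_nonneg _).trans_lt hrp) ENNReal.toReal_nonneg
  have : Nontrivial E :=
    Module.nontrivial_of_finrank_pos (R := ℝ) (by exact_mod_cast hr_pos.trans hr)
  have hsplit : (fun x : E => ‖‖x‖ ^ (-r)‖ₑ) =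
      (fun x => ‖(Metric.ball 0 1).indicator (fun x : E => ‖x‖ ^ (-r)) x‖ₑ) +
        fun x => ‖(Metric.ball 0 1)ᶜ.indicator (fun x : E => ‖x‖ ^ (-r)) x‖ₑ := by
    funext x
    by_cases hx : x ∈ Metric.ball (0 : E) 1 <;> simp [hx]
  rw [hsplit]
  exact memLp_add_lconvolution hp (memLp_one_indicator_ball_norm_rpow_neg hr).enorm
    (memLp_indicator_compl_ball_norm_rpow_neg hp_top hrp).enorm hg₁ hg₂

end Kernel

section BiotSavart

variable {w : E3 → E3}

theorem norm_cross_le (a b : E3) : ‖cross a b‖ ≤ ‖a‖ * ‖b‖ := by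
  rw [cross, InnerProductGeometry.norm_ofLp_crossProduct]
  exact mul_le_of_le_one_right (by positivity) (Real.sin_le_one _)

theorem continuous_cross : Continuous fun p : E3 × E3 => cross p.1 p.2 := by
  unfold cross
  simp only [cross_apply]
  refine (PiLp.continuous_toLp 2 _).comp (continuous_pi fun i => ?_)
  fin_cases i
  all_goals
    dsimp
    fun_prop

theorem aestronglyMeasurable_cross {α : Type*} [MeasurableSpace α] {μ : Measure α} {f g : α → E3}
    (hf : AEStronglyMeasurable f μ) (hg : AEStronglyMeasurable g μ) :
    AEStronglyMeasurable (fun a => cross (f a) (g a)) μ :=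
  continuous_cross.comp_aestronglyMeasurable (hf.prodMk hg)

/-- The Biot–Savart kernel `z / (4π|z|³)`, with the junk value `0` at the origin; `biotSavart`
integrates it against a vorticity. -/
noncomputable def biotSavartKernel (z : E3) : E3 :=
  (1 / (4 * Real.pi * ‖z‖ ^ 3)) • z

theorem measurable_biotSavartKernel : Measurable biotSavartKernel := by
  unfold biotSavartKernel
  fun_prop

theorem norm_biotSavartKernel_le (z : E3) : ‖biotSavartKernel z‖ ≤ ‖z‖ ^ (-2 : ℝ) := by
  have hpi : (1 : ℝ) ≤ 4 * Real.pi := by linarith [Real.pi_gt_three]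
  calc ‖biotSavartKernel z‖ = (4 * Real.pi)⁻¹ * ‖z‖ ^ (-2 : ℝ) := by
        rw [biotSavartKernel, norm_smul, Real.norm_of_nonneg (by positivity),
          Real.rpow_neg (norm_nonneg z), Real.rpow_ofNat]
        rcases eq_or_ne z 0 with rfl | hz
        · simp
        · field_simp
    _ ≤ ‖z‖ ^ (-2 : ℝ) :=
        mul_le_of_le_one_left (by positivity) (inv_le_one_of_one_le₀ hpi)

theorem biotSavart_eq_neg_integral_kernel (w : E3 → E3) :
    biotSavart w = fun x => -∫ y, cross (biotSavartKernel (x - y)) (w y) :=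
  rfl

theorem enorm_biotSavart_le_lconvolution (w : E3 → E3) (x : E3) :
    ‖biotSavart w x‖ₑ ≤ ((fun z : E3 => ‖‖z‖ ^ (-2 : ℝ)‖ₑ) ⋆ₗ fun y => ‖w y‖ₑ) x := by
  rw [biotSavart_eq_neg_integral_kernel, enorm_neg, lconvolution_comm, lconvolution_def]
  refine (enorm_integral_le_lintegral_enorm _).trans (lintegral_mono fun y => ?_)
  rw [neg_add_eq_sub, mul_comm, ← enorm_norm (w y), ← enorm_mul, enorm_le_iff_norm_le]
  calc ‖cross (biotSavartKernel (x - y)) (w y)‖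
      ≤ ‖biotSavartKernel (x - y)‖ * ‖w y‖ := norm_cross_le _ _
    _ ≤ ‖x - y‖ ^ (-2 : ℝ) * ‖w y‖ := by gcongr; exact norm_biotSavartKernel_le _
    _ ≤ ‖‖x - y‖ ^ (-2 : ℝ) * ‖w y‖‖ := Real.le_norm_self _

theorem aestronglyMeasurable_biotSavart (hw : AEStronglyMeasurable w volume) :
    AEStronglyMeasurable (biotSavart w) volume := by
  have hkernel : Measurable fun q : E3 × E3 => biotSavartKernel (q.1 - q.2) :=
    measurable_biotSavartKernel.comp measurable_sub
  have hintegrand : AEStronglyMeasurable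
      (fun q : E3 × E3 => cross (biotSavartKernel (q.1 - q.2)) (w q.2)) (volume.prod volume) :=
    aestronglyMeasurable_cross hkernel.aestronglyMeasurable hw.comp_snd
  rw [biotSavart_eq_neg_integral_kernel]
  exact hintegrand.integral_prod_right'.neg

theorem memLp_biotSavart {p : ℝ≥0∞} (hp : 3 / 2 < p) (hp_top : p ≠ ⊤) (hw₁ : MemLp w 1 volume)
    (hwp : MemLp w p volume) : MemLp (biotSavart w) p volume := by
  have hp_real : 3 / 2 < p.toReal := by
    simpa using (ENNReal.toReal_lt_toReal hp.ne_top hp_top).2 hp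
  have hp_one : 1 ≤ p := by
    rw [← ENNReal.toReal_le_toReal ENNReal.one_ne_top hp_top, ENNReal.toReal_one]
    linarith
  have hdim : (Module.finrank ℝ E3 : ℝ) = 3 := by simp
  have hkernel := memLp_lconvolution_norm_rpow_neg (E := E3) (r := 2) hp_one hp_top
    (by linarith) (by linarith) hw₁.enorm hwp.enorm
  exact hkernel.mono'_enorm (aestronglyMeasurable_biotSavart hw₁.1)
    (ae_of_all _ (enorm_biotSavart_le_lconvolution w))

end BiotSavart

section Hilbert

variable {𝕜 E F : Type*} [RCLike 𝕜] [NormedAddCommGroup E] [InnerProductSpace 𝕜 E]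
  [NormedAddCommGroup F] [InnerProductSpace 𝕜 F]

theorem norm_sub_starProjection_le (K : Submodule 𝕜 E) [K.HasOrthogonalProjection] (x : E) {y : E}
    (hy : y ∈ K) : ‖x - K.starProjection x‖ ≤ ‖x - y‖ := by
  rw [Submodule.starProjection_minimal]
  exact ciInf_le ⟨0, Set.forall_mem_range.2 fun _ => norm_nonneg _⟩ (⟨y, hy⟩ : K)

theorem tendsto_starProjection_of_eventually_mem {ι : Type*} {l : Filter ι} {K : Submodule 𝕜 E}
    [K.HasOrthogonalProjection] {L : ι → Submodule 𝕜 E} [∀ i, (L i).HasOrthogonalProjection]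
    (hL : ∀ i, L i ≤ K) {S : Set E} (hS : (K : Set E) ⊆ closure S)
    (hSL : ∀ s ∈ S, ∀ᶠ i in l, s ∈ L i) (x : E) :
    Tendsto (fun i => (L i).starProjection x) l (𝓝 (K.starProjection x)) := by
  rw [Metric.tendsto_nhds]
  intro ε hε
  obtain ⟨s, hs, hsε⟩ := Metric.mem_closure_iff.1 (hS (K.starProjection_apply_mem x)) ε hε
  filter_upwards [hSL s hs] with i hi
  have hcomp : (L i).starProjection (K.starProjection x) = (L i).starProjection x :=
    DFunLike.congr_fun (Submodule.starProjection_comp_starProjection_of_le (hL i)) x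
  rw [dist_comm, dist_eq_norm, ← hcomp]
  rw [dist_eq_norm] at hsε
  exact (norm_sub_starProjection_le (L i) _ hi).trans_lt hsε

theorem starProjection_map_eq_adjoint [CompleteSpace E] [CompleteSpace F] (J : F →ₗᵢ[𝕜] E)
    (K : Submodule 𝕜 F) [K.HasOrthogonalProjection]
    [(K.map J.toLinearMap).HasOrthogonalProjection] (x : E) :
    (K.map J.toLinearMap).starProjection x =
      J (K.starProjection (J.toContinuousLinearMap.adjoint x)) := by
  refine Submodule.eq_starProjection_of_mem_of_inner_eq_zero (Submodule.apply_coe_mem_map _ _) ?_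
  rintro _ ⟨z, hz, rfl⟩
  change inner 𝕜 (x - J _) (J z) = 0
  have hadj : inner 𝕜 x (J z) = inner 𝕜 (J.toContinuousLinearMap.adjoint x) z :=
    (J.toContinuousLinearMap.adjoint_inner_left z x).symm
  rw [inner_sub_left, J.inner_map_map, hadj, ← inner_sub_left,
    Submodule.starProjection_inner_eq_zero _ _ hz]

end Hilbert

section ExtendZero

variable {α E : Type*} [MeasurableSpace α] {μ : Measure α} [NormedAddCommGroup E]
  {p : ℝ≥0∞} {s : Set α}

theorem memLp_indicator_of_restrict (hs : MeasurableSet s) (f : Lp E p (μ.restrict s)) :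
    MemLp (s.indicator f) p μ :=
  (memLp_indicator_iff_restrict hs).2 (Lp.memLp f)

variable (𝕜 : Type*) [RCLike 𝕜] [NormedSpace 𝕜 E] [Fact (1 ≤ p)]

/-- Extension by zero of an `Lᵖ` function on `s`, as a linear isometry into `Lᵖ` of the whole space.
It turns statements about `extendZero` into statements in one fixed Hilbert space. -/
noncomputable def extendZeroLp (hs : MeasurableSet s) : Lp E p (μ.restrict s) →ₗᵢ[𝕜] Lp E p μ where
  toFun f := (memLp_indicator_of_restrict hs f).toLp _
  map_add' f g := by
    rw [← MemLp.toLp_add, MemLp.toLp_eq_toLp_iff, ← Set.indicator_add']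
    exact (ae_eq_restrict_iff_indicator_ae_eq hs).1 (Lp.coeFn_add f g)
  map_smul' c f := by
    rw [RingHom.id_apply, ← MemLp.toLp_const_smul, MemLp.toLp_eq_toLp_iff]
    refine ((ae_eq_restrict_iff_indicator_ae_eq hs).1 (Lp.coeFn_smul c f)).trans (.of_eq ?_)
    exact Set.indicator_const_smul s c f
  norm_map' f := by
    change ‖(memLp_indicator_of_restrict hs f).toLp _‖ = _
    rw [Lp.norm_toLp, eLpNorm_indicator_eq_eLpNorm_restrict hs, Lp.norm_def]

variable {𝕜}

theorem coeFn_extendZeroLp (hs : MeasurableSet s) (f : Lp E p (μ.restrict s)) :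
    extendZeroLp 𝕜 hs f =ᵐ[μ] s.indicator f :=
  (memLp_indicator_of_restrict hs f).coeFn_toLp

theorem extendZeroLp_eq_iff (hs : MeasurableSet s) {f : Lp E p (μ.restrict s)} {g : Lp E p μ} :
    extendZeroLp 𝕜 hs f = g ↔ s.indicator f =ᵐ[μ] g := by
  rw [Lp.ext_iff]
  exact ⟨(coeFn_extendZeroLp hs f).symm.trans, (coeFn_extendZeroLp hs f).trans⟩

end ExtendZero

theorem adjoint_extendZeroLp {α 𝕜 E : Type*} [MeasurableSpace α] {μ : Measure α} [RCLike 𝕜]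
    [NormedAddCommGroup E] [InnerProductSpace 𝕜 E] [CompleteSpace E] {s : Set α}
    (hs : MeasurableSet s) :
    (extendZeroLp (μ := μ) (E := E) (p := 2) 𝕜 hs).toContinuousLinearMap.adjoint =
      LpToLpRestrictCLM α E 𝕜 μ 2 s := by
  refine ((ContinuousLinearMap.eq_adjoint_iff _ _).2 fun f g => ?_).symm
  change inner 𝕜 (LpToLpRestrictCLM α E 𝕜 μ 2 s f) g = inner 𝕜 f (extendZeroLp 𝕜 hs g)
  have hrestrict : (fun x => inner 𝕜 (LpToLpRestrictCLM α E 𝕜 μ 2 s f x) (g x))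
      =ᵐ[μ.restrict s] fun x => inner 𝕜 (f x) (g x) := by
    filter_upwards [LpToLpRestrictCLM_coeFn 𝕜 s f] with x hx
    rw [hx]
  have hextend : (fun x => inner 𝕜 (f x) (extendZeroLp 𝕜 hs g x))
      =ᵐ[μ] s.indicator fun x => inner 𝕜 (f x) (g x) := by
    filter_upwards [coeFn_extendZeroLp (𝕜 := 𝕜) hs g] with x hx
    by_cases hxs : x ∈ s <;> simp [hx, hxs]
  rw [L2.inner_def, L2.inner_def, integral_congr_ae hrestrict, integral_congr_ae hextend,
    integral_indicator hs]

section Solenoidal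

variable {Ω : Set E3}

theorem divergence_eq_zero_of_notMem_tsupport {φ : E3 → E3} {x : E3} (hx : x ∉ tsupport φ) :
    divergence φ x = 0 := by
  have hfderiv : fderiv ℝ φ x = 0 :=
    image_eq_zero_of_notMem_tsupport fun h => hx (tsupport_fderiv_subset ℝ h)
  simp [divergence, hfderiv]

theorem mem_solenoidalTest_of_tsupport_subset {U : Set E3} {φ : E3 → E3}
    (hφ : φ ∈ solenoidalTest Ω) (hφU : tsupport φ ⊆ U) : φ ∈ solenoidalTest U := by
  obtain ⟨hsmooth, hcompact, hφΩ, hdiv⟩ := hφ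
  refine ⟨hsmooth, hcompact, hφU, fun x _ => ?_⟩
  by_cases hx : x ∈ tsupport φ
  · exact hdiv x (hφΩ hx)
  · exact divergence_eq_zero_of_notMem_tsupport hx

/-- The classes in `L²(ℝ³)`, rather than in `L²(Ω)`, of the fields in `V(Ω)`: unlike
`solenoidalTestL2 Ω`, these can be compared for different `Ω`. -/
def solenoidalTestClasses (Ω : Set E3) : Set (Lp E3 2 (volume : Measure E3)) :=
  {f | ∃ φ ∈ solenoidalTest Ω, f =ᵐ[volume] φ}

/-- The space `𝓗(Ω)`, regarded as a subspace of `L²(ℝ³)` through extension by zero. -/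
noncomputable def extendedSolenoidalSpace (hΩ : MeasurableSet Ω) :
    Submodule ℝ (Lp E3 2 (volume : Measure E3)) :=
  (solenoidalSpace Ω).map (extendZeroLp ℝ hΩ).toLinearMap

instance (hΩ : MeasurableSet Ω) : (extendedSolenoidalSpace hΩ).HasOrthogonalProjection :=
  have : CompleteSpace (solenoidalSpace Ω) :=
    inferInstanceAs (CompleteSpace (solenoidalTestL2 Ω).topologicalClosure)
  have : CompleteSpace (extendedSolenoidalSpace hΩ) :=
    LinearIsometry.completeSpace_map (extendZeroLp ℝ hΩ) (solenoidalSpace Ω)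
  Submodule.HasOrthogonalProjection.ofCompleteSpace _

theorem image_extendZeroLp_solenoidalTestL2 (hΩ : MeasurableSet Ω) :
    extendZeroLp ℝ hΩ '' (solenoidalTestL2 Ω : Set (L2Field Ω)) = solenoidalTestClasses Ω := by
  ext f
  constructor
  · rintro ⟨g, ⟨φ, hφ, hg⟩, rfl⟩
    refine ⟨φ, hφ, (coeFn_extendZeroLp hΩ g).trans ?_⟩
    rwa [← Set.indicator_eq_self.2 ((subset_tsupport φ).trans hφ.2.2.1),
      ← ae_eq_restrict_iff_indicator_ae_eq hΩ]
  · rintro ⟨φ, hφ, hf⟩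
    have hmem : MemLp φ 2 (volume.restrict Ω) :=
      hφ.1.continuous.memLp_of_hasCompactSupport hφ.2.1
    refine ⟨hmem.toLp φ, ⟨φ, hφ, hmem.coeFn_toLp⟩, (extendZeroLp_eq_iff hΩ).2 ?_⟩
    refine ((ae_eq_restrict_iff_indicator_ae_eq hΩ).1 hmem.coeFn_toLp).trans ?_
    rw [Set.indicator_eq_self.2 ((subset_tsupport φ).trans hφ.2.2.1)]
    exact hf.symm

theorem coe_extendedSolenoidalSpace (hΩ : MeasurableSet Ω) :
    (extendedSolenoidalSpace hΩ : Set (Lp E3 2 volume)) = closure (solenoidalTestClasses Ω) := by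
  rw [← image_extendZeroLp_solenoidalTestL2 hΩ,
    (extendZeroLp ℝ hΩ).isometry.isClosedEmbedding.closure_image_eq]
  rfl

theorem extendZeroLp_lerayProjection (hΩ : MeasurableSet Ω) {v : E3 → E3}
    (hv : MemLp v 2 volume) :
    extendZeroLp ℝ hΩ (lerayProjection Ω (restrictL2 Ω hv) : L2Field Ω) =
      (extendedSolenoidalSpace hΩ).starProjection (hv.toLp v) := by
  have hv_ae : hv.toLp v =ᵐ[volume.restrict Ω] v := ae_restrict_of_ae hv.coeFn_toLp
  have hrestrict : LpToLpRestrictCLM E3 E3 ℝ volume 2 Ω (hv.toLp v) = restrictL2 Ω hv :=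
    Lp.ext ((LpToLpRestrictCLM_coeFn ℝ Ω _).trans
      (hv_ae.trans (hv.restrict Ω).coeFn_toLp.symm))
  have : ((solenoidalSpace Ω).map (extendZeroLp ℝ hΩ).toLinearMap).HasOrthogonalProjection :=
    inferInstanceAs (extendedSolenoidalSpace hΩ).HasOrthogonalProjection
  rw [← hrestrict, ← adjoint_extendZeroLp hΩ]
  exact (starProjection_map_eq_adjoint _ _ _).symm

section Exhaustion

variable {ι : Type*} {l : Filter ι} {U : ι → Set E3} {v : E3 → E3}

theorem tendsto_extendZeroLp_lerayProjection (hΩ : MeasurableSet Ω)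
    (hU : ∀ i, MeasurableSet (U i)) (hUΩ : ∀ i, U i ⊆ Ω)
    (hexhaust : ∀ K ⊆ Ω, IsCompact K → ∀ᶠ i in l, K ⊆ U i) (hv : MemLp v 2 volume) :
    Tendsto (fun i => extendZeroLp ℝ (hU i)
        (lerayProjection (U i) (restrictL2 (U i) hv) : L2Field (U i))) l
      (𝓝 (extendZeroLp ℝ hΩ (lerayProjection Ω (restrictL2 Ω hv) : L2Field Ω))) := by
  simp only [extendZeroLp_lerayProjection]
  refine tendsto_starProjection_of_eventually_mem (S := solenoidalTestClasses Ω) (fun i => ?_)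
    (coe_extendedSolenoidalSpace hΩ).subset ?_ _
  · rw [← SetLike.coe_subset_coe, coe_extendedSolenoidalSpace, coe_extendedSolenoidalSpace]
    exact closure_mono fun f ⟨φ, hφ, hf⟩ =>
      ⟨φ, mem_solenoidalTest_of_tsupport_subset hφ (hφ.2.2.1.trans (hUΩ i)), hf⟩
  · rintro f ⟨φ, hφ, hf⟩
    filter_upwards [hexhaust _ hφ.2.2.1 hφ.2.1.isCompact] with i hi
    rw [← SetLike.mem_coe, coe_extendedSolenoidalSpace]
    exact subset_closure ⟨φ, mem_solenoidalTest_of_tsupport_subset hφ hi, hf⟩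

theorem tendsto_eLpNorm_extendZero_lerayProjection (hΩ : MeasurableSet Ω)
    (hU : ∀ i, MeasurableSet (U i)) (hUΩ : ∀ i, U i ⊆ Ω)
    (hexhaust : ∀ K ⊆ Ω, IsCompact K → ∀ᶠ i in l, K ⊆ U i) (hv : MemLp v 2 volume) :
    Tendsto (fun i => eLpNorm
        (extendZero (U i) (lerayProjection (U i) (restrictL2 (U i) hv) : L2Field (U i))
          - ⇑(lerayProjection Ω (restrictL2 Ω hv) : L2Field Ω)) 2 (volume.restrict Ω)) l
      (𝓝 0) := by
  have hconv := (Lp.tendsto_Lp_iff_tendsto_eLpNorm' _ _).1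
    (tendsto_extendZeroLp_lerayProjection hΩ hU hUΩ hexhaust hv)
  refine tendsto_of_tendsto_of_tendsto_of_le_of_le tendsto_const_nhds hconv
    (fun _ => zero_le) fun i => ?_
  have happrox (f : L2Field (U i)) :
      extendZero (U i) f =ᵐ[volume.restrict Ω] extendZeroLp ℝ (hU i) f :=
    ae_restrict_of_ae (coeFn_extendZeroLp (hU i) f).symm
  have hlimit (f : L2Field Ω) : f =ᵐ[volume.restrict Ω] extendZeroLp ℝ hΩ f :=
    (indicator_ae_eq_restrict hΩ).symm.trans (ae_restrict_of_ae (coeFn_extendZeroLp hΩ f).symm)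
  exact (eLpNorm_congr_ae ((happrox _).sub (hlimit _))).le.trans (eLpNorm_restrict_le _ _ _ Ω)

end Exhaustion

end Solenoidal

theorem eventually_subset_compl_of_tendsto_hausdorffEDist {X ι : Type*} [PseudoEMetricSpace X]
    {l : Filter ι} {C K : Set X} {Cn : ι → Set X} (hC : IsClosed C) (hK : IsCompact K)
    (hKC : K ⊆ Cᶜ) (hconv : Tendsto (fun i => Metric.hausdorffEDist (Cn i) C) l (𝓝 0)) :
    ∀ᶠ i in l, K ⊆ (Cn i)ᶜ := by
  obtain ⟨r, hr, hlt⟩ := Metric.exists_pos_forall_lt_edist hK hC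
    (Set.subset_compl_iff_disjoint_right.1 hKC)
  filter_upwards [hconv.eventually_lt_const (ENNReal.coe_pos.2 hr)] with i hi x hxK hxi
  obtain ⟨y, hy, hxy⟩ := Metric.exists_edist_lt_of_hausdorffEDist_lt hxi hi
  exact (hlt x hxK y hy).not_gt hxy

theorem mainTheorem4_general {ι : Type*} {l : Filter ι} {C : Set E3} (hC : IsClosed C)
    {Cn : ι → Set E3} (hCn : ∀ i, MeasurableSet (Cn i)) (hsub : ∀ i, C ⊆ Cn i)
    (hconv : Tendsto (fun i => Metric.hausdorffEDist (Cn i) C) l (𝓝 0)) {ω₀ : E3 → E3}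
    (hω₁ : MemLp ω₀ 1 volume) (hω₂ : MemLp ω₀ 2 volume) :
    ∃ hv : MemLp (biotSavart ω₀) 2 volume,
      Tendsto
        (fun i => eLpNorm
          (extendZero (Cn i)ᶜ (lerayProjection (Cn i)ᶜ (restrictL2 (Cn i)ᶜ hv) : L2Field (Cn i)ᶜ)
            - ⇑(lerayProjection Cᶜ (restrictL2 Cᶜ hv) : L2Field Cᶜ))
          2 (volume.restrict Cᶜ))
        l (𝓝 0) := by
  have htwo : (3 / 2 : ℝ≥0∞) < 2 := ENNReal.div_lt_of_lt_mul (by norm_num)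
  refine ⟨memLp_biotSavart htwo ENNReal.ofNat_ne_top hω₁ hω₂, ?_⟩
  exact tendsto_eLpNorm_extendZero_lerayProjection hC.measurableSet.compl
    (fun i => (hCn i).compl) (fun i => Set.compl_subset_compl.2 (hsub i))
    (fun _ hKC hK => eventually_subset_compl_of_tendsto_hausdorffEDist hC hK hKC hconv) _

theorem mainTheorem4 (C : Set E3) (hC : IsObstacle C)
    (Cn : ℕ → Set E3) (hCn : ∀ n, IsSmoothObstacle (Cn n))
    (hsub : ∀ n, C ⊆ Cn n)
    (hconv : Tendsto (fun n => Metric.hausdorffEDist (Cn n) C) atTop (𝓝 0))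
    (ω₀ : E3 → E3) (hω₀ : ω₀ ∈ solenoidalTest Set.univ) :
    ∃ hv : MemLp (biotSavart ω₀) 2 volume,
      Tendsto
        (fun n => eLpNorm
          (extendZero (Cn n)ᶜ (lerayProjection (Cn n)ᶜ (restrictL2 (Cn n)ᶜ hv) : L2Field (Cn n)ᶜ)
            - ⇑(lerayProjection Cᶜ (restrictL2 Cᶜ hv) : L2Field Cᶜ))
          2 (volume.restrict Cᶜ))
        atTop (𝓝 0) := by
  have hmemLp (p : ℝ≥0∞) : MemLp ω₀ p volume :=
    hω₀.1.continuous.memLp_of_hasCompactSupport hω₀.2.1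
  exact mainTheorem4_general hC.isCompact.isClosed (fun n => (hCn n).isCompact.measurableSet)
    hsub hconv (hmemLp 1) (hmemLp 2)
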